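/- For a finite group $G$ let Harada's number be $$h(G)=\frac{\prod_{K}|K|}{\prod_{\chi}\chi(1)},$$ where $K$ runs over the conjugacy classes of $G$ and $\chi$ over the irreducible complex characters of $G$, and let $G'$ denote the commutator subgroup of $G$. Let $n\ge 1$ be an integer and let $$G=\mathrm{D}_{2n}=\langle \sigma,\tau \mid \sigma^n=\tau^2=1,\ \tau^{-1}\sigma\tau=\sigma^{-1}\rangle$$ be the dihedral group of order $2n$. Then $$h(G)=\begin{cases} n=|G'| & \text{if } n \text{ is odd},\\[2pt] \dfrac{n^2}{4}=|G'|^2 & \text{if } n \text{ is even}.\end{cases}$$ -/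

import Mathlib

/-- The set of irreducible (ordinary) characters of `G`: the functions `g ↦ tr ρ(g)`, for `ρ` an
irreducible representation of `G` on a finite-dimensional complex vector space (which may be
taken to be `ℂ ^ d`). -/
def irrChars (G : Type*) [Group G] : Set (G → ℂ) :=
  {χ | ∃ (d : ℕ) (ρ : Representation ℂ G (Fin d → ℂ)), ρ.IsIrreducible ∧ χ = ρ.character}

/-- A finite group has only finitely many irreducible characters. -/
theorem irrChars_finite (G : Type*) [Group G] [Finite G] : (irrChars G).Finite := by
  classical
  have : Fintype G := Fintype.ofFinite G
  have : Invertible (Nat.card G : ℂ) :=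
    invertibleOfNonzero (Nat.cast_ne_zero.mpr Nat.card_pos.ne')
  have key : ∀ χ ∈ irrChars G, ∀ ψ ∈ irrChars G,
      (Nat.card G : ℂ)⁻¹ * ∑ g : G, χ g * ψ g⁻¹ = if χ = ψ then 1 else 0 := by
    rintro _ ⟨d, ρ, hρ, rfl⟩ _ ⟨e, σ, hσ, rfl⟩
    split_ifs with h
    · rw [← h, Representation.char_orthonormal, if_pos ⟨Representation.Equiv.refl ρ⟩]
    · rw [Representation.char_orthonormal, if_neg]
      rintro ⟨φ⟩
      exact h (Representation.char_iso φ).symm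
  have hli : LinearIndependent ℂ (fun χ : irrChars G => (χ : G → ℂ)) := by
    rw [linearIndependent_iff']
    intro s c hc ψ hψ
    have h0 : (Nat.card G : ℂ)⁻¹ *
        ∑ g : G, (∑ χ ∈ s, c χ • (χ : G → ℂ)) g * (ψ : G → ℂ) g⁻¹ = 0 := by
      rw [hc]; simp
    have h1 : ∑ χ ∈ s, c χ * ((Nat.card G : ℂ)⁻¹ *
        ∑ g : G, (χ : G → ℂ) g * (ψ : G → ℂ) g⁻¹) = 0 := by
      rw [← h0]
      simp only [Finset.sum_apply, Pi.smul_apply, smul_eq_mul, Finset.sum_mul, Finset.mul_sum]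
      rw [Finset.sum_comm]
      refine Finset.sum_congr rfl fun g _ => Finset.sum_congr rfl fun χ _ => ?_
      ring
    rw [Finset.sum_eq_single ψ] at h1
    · rwa [key ψ.1 ψ.2 ψ.1 ψ.2, if_pos rfl, mul_one] at h1
    · intro χ _ hne
      rw [key χ.1 χ.2 ψ.1 ψ.2, if_neg (fun h => hne (Subtype.ext h)), mul_zero]
    · exact fun h => absurd hψ h
  have : Finite (irrChars G) := hli.finite
  exact Set.toFinite _

/-- Harada's number of a finite group `G`,
`h(G) = (∏ over the conjugacy classes K of |K|) / (∏ over the irreducible characters χ of χ(1))`.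
For finite `G` both products are over finite sets, the second one by `irrChars_finite`; the
degrees `χ 1` are positive integers, so the value is a rational number, regarded here as an
element of `ℂ`. -/
noncomputable def haradaNumber (G : Type*) [Group G] : ℂ :=
  (∏ᶠ K : ConjClasses G, (Nat.card K.carrier : ℂ)) / ∏ᶠ χ ∈ irrChars G, χ 1

open DihedralGroup

/-! Rotation classes have size one or two, and irreducible characters have degree one or two. In
both cases the twos are indexed by the residues `i ≠ -i` up to sign (`mk_r_eq_mk_r`,
`twoDimChar_eq_iff`), so the powers of two in `h(G)` cancel without being counted. What survives
comes from the reflections: their classes correspond to the cosets of `doubles n`, which leaves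
`|doubles n|` to the power of its index `gcd(n, 2)`. Since `G'` consists of the rotations by
doubles, this is `|G'|` or `|G'|²`. -/

theorem Set.ncard_image_eq_ncard_image_of_iff {α β γ : Type*} {f : α → β} {g : α → γ} {s : Set α}
    (h : ∀ x ∈ s, ∀ y ∈ s, f x = f y ↔ g x = g y) : (f '' s).ncard = (g '' s).ncard := by
  classical
  have hx : ∀ b : f '' s, ∃ x, x ∈ s ∧ f x = b := fun b => b.2
  choose p hps hp using hx
  refine Set.ncard_congr (fun b hb => g (p ⟨b, hb⟩)) (fun b hb => ⟨_, hps _, rfl⟩) ?_ ?_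
  · intro a b ha hb hab
    have := (h _ (hps ⟨a, ha⟩) _ (hps ⟨b, hb⟩)).2 hab
    rwa [hp, hp] at this
  · rintro _ ⟨x, hx, rfl⟩
    exact ⟨f x, ⟨x, hx, rfl⟩, (h _ (hps _) _ hx).1 (hp _)⟩

theorem finprod_mem_eq_pow_ncard {α M : Type*} [CommMonoid M] {f : α → M} {s : Set α} {c : M}
    (hs : s.Finite) (h : ∀ x ∈ s, f x = c) : ∏ᶠ x ∈ s, f x = c ^ s.ncard := by
  rw [finprod_mem_eq_finite_toFinset_prod f hs, Set.ncard_eq_toFinset_card s hs]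
  exact Finset.prod_eq_pow_card fun x hx => h x (by simpa using hx)

namespace ZMod

/-- The subgroup of doubles in `ZMod n`. -/
def doubles (n : ℕ) : AddSubgroup (ZMod n) := (nsmulAddMonoidHom (α := ZMod n) 2).range

theorem mem_doubles {n : ℕ} {i : ZMod n} : i ∈ doubles n ↔ ∃ j, 2 * j = i := by
  simp [doubles, AddMonoidHom.mem_range]

theorem card_doubles (n : ℕ) [NeZero n] : Nat.card (doubles n) = n / n.gcd 2 := by
  rw [doubles, IsAddCyclic.card_nsmulAddMonoidHom_range, Nat.card_zmod]

theorem index_doubles (n : ℕ) [NeZero n] : (doubles n).index = n.gcd 2 := by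
  rw [doubles, IsAddCyclic.index_nsmulAddMonoidHom_range, Nat.card_zmod]

/-- The residues that differ from their negatives. -/
def nonSelfNeg (n : ℕ) : Set (ZMod n) := {i | i ≠ -i}

end ZMod

/-! ### Conjugacy classes and commutator subgroup -/

namespace DihedralGroup

open ZMod

variable {n : ℕ}

theorem mk_r_eq_mk_r {i j : ZMod n} :
    ConjClasses.mk (r i) = ConjClasses.mk (r j) ↔ j = i ∨ j = -i := by
  rw [ConjClasses.mk_eq_mk_iff_isConj, isConj_iff]
  constructor
  · rintro ⟨k | k, h⟩ <;> simp at h <;> simp [← h]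
  · rintro (rfl | rfl)
    · exact ⟨1, by simp⟩
    · exact ⟨sr 0, by simp⟩

theorem mk_sr_eq_mk_sr {i j : ZMod n} :
    ConjClasses.mk (sr i) = ConjClasses.mk (sr j) ↔ -i + j ∈ doubles n := by
  rw [ConjClasses.mk_eq_mk_iff_isConj, isConj_iff, mem_doubles]
  constructor
  · rintro ⟨k | k, h⟩ <;> simp at h <;> rw [← h]
    · exact ⟨-k, by ring⟩
    · exact ⟨k - i, by ring⟩
  · rintro ⟨k, hk⟩
    exact ⟨r (-k), by simp; linear_combination hk⟩

theorem mk_r_ne_mk_sr (i j : ZMod n) : ConjClasses.mk (r i) ≠ ConjClasses.mk (sr j) := by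
  rw [Ne, ConjClasses.mk_eq_mk_iff_isConj, isConj_iff]
  rintro ⟨k | k, h⟩ <;> simp at h

theorem carrier_mk_r (i : ZMod n) : (ConjClasses.mk (r i)).carrier = {r i, r (-i)} := by
  ext (j | j)
  · rw [ConjClasses.mem_carrier_iff_mk_eq, eq_comm, mk_r_eq_mk_r]
    simp
  · simp [ConjClasses.mem_carrier_iff_mk_eq, (mk_r_ne_mk_sr i j).symm]

theorem card_carrier_mk_sr (i : ZMod n) :
    Nat.card (ConjClasses.mk (sr i)).carrier = Nat.card (doubles n) := by
  have : (ConjClasses.mk (sr i)).carrier = (fun k => sr (i + k)) '' (doubles n : Set (ZMod n)) := by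
    ext (j | j)
    · simp [ConjClasses.mem_carrier_iff_mk_eq, mk_r_ne_mk_sr j i]
    · rw [ConjClasses.mem_carrier_iff_mk_eq, eq_comm, mk_sr_eq_mk_sr]
      constructor
      · exact fun h => ⟨_, h, by simp⟩
      · rintro ⟨k, hk, h⟩
        simp at h
        simpa [← h] using hk
  rw [this]
  exact Nat.card_image_of_injective (fun a b h => by simpa using h) _

theorem finprod_card_conjClasses [NeZero n] :
    ∏ᶠ K : ConjClasses (DihedralGroup n), (Nat.card K.carrier : ℂ) =
      2 ^ ((fun i : ZMod n => ConjClasses.mk (r i)) '' nonSelfNeg n).ncard *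
        (Nat.card (doubles n) : ℂ) ^ (doubles n).index := by
  let ρ : ZMod n → ConjClasses (DihedralGroup n) := fun i => ConjClasses.mk (r i)
  let s : ZMod n → ConjClasses (DihedralGroup n) := fun i => ConjClasses.mk (sr i)
  have hu : Set.univ = Set.range ρ ∪ Set.range s := by
    refine (Set.eq_univ_of_forall fun K => ?_).symm
    obtain ⟨j | j, rfl⟩ := K.exists_rep
    · exact Or.inl ⟨j, rfl⟩
    · exact Or.inr ⟨j, rfl⟩
  have hd : Disjoint (Set.range ρ) (Set.range s) := by
    rw [Set.disjoint_left]
    rintro _ ⟨i, rfl⟩ ⟨j, h⟩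
    exact mk_r_ne_mk_sr i j h.symm
  have hcard : ∀ i : ZMod n, i ∈ nonSelfNeg n → Nat.card (ρ i).carrier = 2 := by
    intro i hi
    rw [carrier_mk_r, Nat.card_coe_set_eq, Set.ncard_pair (by simpa [nonSelfNeg] using hi)]
  rw [← finprod_mem_univ, hu, finprod_mem_union hd (Set.finite_range _) (Set.finite_range _)]
  congr 1
  · rw [← finprod_mem_eq_pow_ncard ((nonSelfNeg n).toFinite.image ρ)
      (f := fun K => (Nat.card K.carrier : ℂ))]
    -- Central rotations form singleton classes, which contribute a factor 1 and can be dropped.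
    · refine finprod_mem_inter_mulSupport_eq' _ _ _ fun K hK => ⟨?_, ?_⟩
      · rintro ⟨i, rfl⟩
        refine ⟨i, fun h => hK ?_, rfl⟩
        simp only [ρ]
        rw [carrier_mk_r, ← h]
        simp
      · rintro ⟨i, -, rfl⟩
        exact ⟨i, rfl⟩
    · rintro _ ⟨i, hi, rfl⟩
      exact_mod_cast hcard i hi
  · rw [finprod_mem_eq_pow_ncard (Set.finite_range s) (c := (Nat.card (doubles n) : ℂ))]
    · congr 1
      rw [← Set.image_univ, Set.ncard_image_eq_ncard_image_of_iff
        (g := (QuotientAddGroup.mk : ZMod n → ZMod n ⧸ doubles n))]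
      · rw [Set.image_univ, Set.range_eq_univ.2 QuotientAddGroup.mk_surjective, Set.ncard_univ,
          AddSubgroup.index]
      · intro i _ j _
        rw [QuotientAddGroup.eq]
        exact mk_sr_eq_mk_sr
    · rintro _ ⟨i, rfl⟩
      exact congrArg _ (card_carrier_mk_sr i)

theorem coe_commutator :
    (commutator (DihedralGroup n) : Set (DihedralGroup n)) =
      r '' (doubles n : Set (ZMod n)) := by
  let H : Subgroup (DihedralGroup n) :=
    { carrier := r '' (doubles n : Set (ZMod n))
      one_mem' := ⟨0, zero_mem _, rfl⟩
      mul_mem' := by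
        rintro _ _ ⟨a, ha, rfl⟩ ⟨b, hb, rfl⟩
        exact ⟨a + b, add_mem ha hb, by simp⟩
      inv_mem' := by
        rintro _ ⟨a, ha, rfl⟩
        exact ⟨-a, neg_mem ha, by simp⟩ }
  refine Set.Subset.antisymm (?_ : commutator (DihedralGroup n) ≤ H) ?_
  · rw [commutator_def, Subgroup.commutator_le]
    rintro (a | a) - (b | b) -
    · exact ⟨0, zero_mem _, by simp [commutatorElement_def]⟩
    · exact ⟨2 * a, mem_doubles.2 ⟨_, rfl⟩, by simp [commutatorElement_def]; ring⟩
    · exact ⟨2 * -b, mem_doubles.2 ⟨_, rfl⟩, by simp [commutatorElement_def]; ring⟩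
    · exact ⟨2 * (b - a), mem_doubles.2 ⟨_, rfl⟩, by simp [commutatorElement_def]; ring⟩
  · rintro _ ⟨_, hi, rfl⟩
    obtain ⟨j, rfl⟩ := mem_doubles.1 hi
    -- Every double is a single commutator, so no closure argument is needed.
    have : r (2 * j) = r j * sr 0 * (r j)⁻¹ * (sr 0)⁻¹ := by simp; ring
    rw [this, ← commutatorElement_def]
    exact Subgroup.commutator_mem_commutator (Subgroup.mem_top _) (Subgroup.mem_top _)

theorem card_commutator : Nat.card (commutator (DihedralGroup n)) = Nat.card (doubles n) := by
  refine (congrArg (fun s : Set (DihedralGroup n) => Nat.card s) coe_commutator).trans ?_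
  exact Nat.card_image_of_injective (fun a b h => by simpa using h) _

end DihedralGroup

/-! ### Irreducibility through invariant subspaces -/

namespace Representation

variable {k G V : Type*} [Field k] [Monoid G] [AddCommGroup V] [Module k V]
  {ρ : Representation k G V}

theorem IsIrreducible.eq_top (h : ρ.IsIrreducible) {W : Submodule k V}
    (hW : ∀ g, ∀ w ∈ W, ρ g w ∈ W) {v : V} (hv : v ∈ W) (hv0 : v ≠ 0) : W = ⊤ := by
  rcases h.eq_bot_or_eq_top ⟨W, hW⟩ with h | h
  · have : W = ⊥ := congrArg Subrepresentation.toSubmodule h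
    exact absurd ((Submodule.mem_bot k).1 (this ▸ hv)) hv0
  · exact congrArg Subrepresentation.toSubmodule h

theorem isIrreducible_of_forall_eq_top [Nontrivial V]
    (h : ∀ W : Submodule k V, (∀ g, ∀ w ∈ W, ρ g w ∈ W) → ∀ v ∈ W, v ≠ 0 → W = ⊤) :
    ρ.IsIrreducible where
  exists_pair_ne := ⟨⊥, ⊤, fun e =>
    bot_ne_top (α := Submodule k V) (congrArg Subrepresentation.toSubmodule e)⟩
  eq_bot_or_eq_top W := by
    refine or_iff_not_imp_left.2 fun hW => Subrepresentation.toSubmodule_injective ?_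
    obtain ⟨v, hv, hv0⟩ := W.toSubmodule.exists_mem_ne_zero_of_ne_bot
      fun e => hW (Subrepresentation.toSubmodule_injective e)
    exact h _ W.apply_mem_toSubmodule v hv hv0

theorem IsIrreducible.nontrivial (h : ρ.IsIrreducible) : Nontrivial V := by
  by_contra hV
  rw [not_nontrivial_iff_subsingleton] at hV
  exact bot_ne_top (α := Subrepresentation ρ)
    (Subrepresentation.toSubmodule_injective (Subsingleton.elim _ _))

/-- A common eigenvector spans an invariant line, which must be the whole space. -/
theorem IsIrreducible.character_one_eq_one [FiniteDimensional k V] (h : ρ.IsIrreducible) {v : V}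
    (hv0 : v ≠ 0) (hv : ∀ g, ∃ c : k, ρ g v = c • v) : ρ.character 1 = 1 := by
  have hW : Submodule.span k {v} = ⊤ := by
    refine h.eq_top (fun g w hw => ?_) (Submodule.mem_span_singleton_self v) hv0
    obtain ⟨a, rfl⟩ := Submodule.mem_span_singleton.1 hw
    obtain ⟨c, hc⟩ := hv g
    rw [map_smul, hc]
    exact Submodule.smul_mem _ _ (Submodule.smul_mem _ _ (Submodule.mem_span_singleton_self v))
  rw [char_one, ← finrank_top, ← hW, finrank_span_singleton hv0, Nat.cast_one]

end Representation

/-! ### Irreducible characters of the dihedral group -/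

namespace DihedralGroup

open ZMod

variable {n : ℕ} [NeZero n]

/-- The character of the two-dimensional representation of `DihedralGroup n` in which the rotation
`r 1` has the eigenvalues `stdAddChar i` and `stdAddChar (-i)`. -/
noncomputable def twoDimChar (i : ZMod n) : DihedralGroup n → ℂ
  | r j => stdAddChar (i * j) + stdAddChar (-(i * j))
  | sr _ => 0

theorem twoDimChar_one (i : ZMod n) : twoDimChar i 1 = 2 := by
  rw [one_def, twoDimChar]
  norm_num

theorem twoDimChar_eq_iff {i j : ZMod n} : twoDimChar i = twoDimChar j ↔ j = i ∨ j = -i := by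
  constructor
  · intro h
    have h1 := congrFun h (r 1)
    simp only [twoDimChar, mul_one] at h1
    have hi : stdAddChar i * stdAddChar (-i) = (1 : ℂ) := by
      rw [← AddChar.map_add_eq_mul, add_neg_cancel, AddChar.map_zero_eq_one]
    have hj : stdAddChar j * stdAddChar (-j) = (1 : ℂ) := by
      rw [← AddChar.map_add_eq_mul, add_neg_cancel, AddChar.map_zero_eq_one]
    -- Both pairs of eigenvalues have product 1 and equal sums, hence are the roots of one
    -- quadratic.
    have : (stdAddChar j - stdAddChar i) * (stdAddChar j - stdAddChar (-i)) = (0 : ℂ) := by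
      linear_combination hi - hj - stdAddChar j * h1
    rcases mul_eq_zero.1 this with h | h
    · exact Or.inl (injective_stdAddChar (sub_eq_zero.1 h))
    · exact Or.inr (injective_stdAddChar (sub_eq_zero.1 h))
  · rintro (rfl | rfl)
    · rfl
    · ext (j | j)
      · simp [twoDimChar, add_comm]
      · rfl

theorem exists_stdAddChar_eq {μ : ℂ} (h : μ ^ n = 1) : ∃ i : ZMod n, stdAddChar i = μ := by
  have hp : IsPrimitiveRoot (stdAddChar (1 : ZMod n) : ℂ) n := by
    refine ⟨?_, fun l hl => ?_⟩
    · rw [← AddChar.map_nsmul_eq_pow]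
      simp
    · rw [← AddChar.map_nsmul_eq_pow, ← AddChar.map_zero_eq_one (stdAddChar (N := n))] at hl
      simpa [ZMod.natCast_eq_zero_iff] using injective_stdAddChar hl
  obtain ⟨k, -, hk⟩ := hp.eq_pow_of_pow_eq_one h
  exact ⟨k • 1, by rw [AddChar.map_nsmul_eq_pow, hk]⟩

theorem exists_rotation_eigenvector {V : Type*} [AddCommGroup V] [Module ℂ V]
    [FiniteDimensional ℂ V] [Nontrivial V] (ρ : Representation ℂ (DihedralGroup n) V) :
    ∃ (i : ZMod n) (v : V), v ≠ 0 ∧ ∀ j, ρ (r j) v = (stdAddChar (i * j) : ℂ) • v := by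
  obtain ⟨μ, hμ⟩ := Module.End.exists_eigenvalue (ρ (r 1))
  obtain ⟨v, hv⟩ := hμ.exists_hasEigenvector
  have hpow : ∀ m : ℕ, ρ (r m) v = μ ^ m • v := fun m => by
    rw [← r_one_pow, map_pow, hv.pow_apply]
  have hμn : μ ^ n = 1 := by
    have := hpow n
    rw [ZMod.natCast_self, r_zero, map_one, Module.End.one_apply] at this
    refine sub_eq_zero.1 ((smul_eq_zero.1 ?_).resolve_right hv.2)
    rw [sub_smul, one_smul, ← this, sub_self]
  obtain ⟨i, rfl⟩ := exists_stdAddChar_eq hμn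
  refine ⟨i, v, hv.2, fun j => ?_⟩
  have := hpow j.val
  rwa [ZMod.natCast_zmod_val, ← AddChar.map_nsmul_eq_pow, nsmul_eq_mul, ZMod.natCast_zmod_val,
    mul_comm] at this

/-- A rotation eigenvector `v` and its mirror image `w` span an invariant subspace. They form a
basis with the expected trace unless they are dependent or `i = -i`; then `v`, respectively `v + w`,
is a common eigenvector and the degree is one. -/
theorem character_eq_twoDimChar {V : Type*} [AddCommGroup V] [Module ℂ V]
    [FiniteDimensional ℂ V] {ρ : Representation ℂ (DihedralGroup n) V} (hρ : ρ.IsIrreducible) :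
    ρ.character 1 = 1 ∨ ∃ i ∈ nonSelfNeg n, ρ.character = twoDimChar i := by
  have := hρ.nontrivial
  obtain ⟨i, v, hv0, hv⟩ := exists_rotation_eigenvector ρ
  obtain ⟨w, hw⟩ : ∃ w, w = ρ (sr 0) v := ⟨_, rfl⟩
  have hsv : ∀ j, ρ (sr j) v = (stdAddChar (i * j) : ℂ) • w := fun j => by
    rw [hw, ← _root_.map_smul, ← hv, ← Module.End.mul_apply, ← map_mul, sr_mul_r, zero_add]
  have hrw : ∀ j, ρ (r j) w = (stdAddChar (-(i * j)) : ℂ) • w := fun j => by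
    rw [← mul_neg, ← hsv, hw, ← Module.End.mul_apply, ← map_mul, r_mul_sr, zero_sub]
  have hsw : ∀ j, ρ (sr j) w = (stdAddChar (-(i * j)) : ℂ) • v := fun j => by
    rw [← mul_neg, ← hv, hw, ← Module.End.mul_apply, ← map_mul, sr_mul_sr, zero_sub]
  by_cases hli : LinearIndependent ℂ ![v, w]
  · by_cases hi : i ∈ nonSelfNeg n
    · refine Or.inr ⟨i, hi, ?_⟩
      have hspan : Submodule.span ℂ (Set.range ![v, w]) = ⊤ := by
        have hv' : v ∈ Submodule.span ℂ (Set.range ![v, w]) := Submodule.subset_span ⟨0, rfl⟩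
        have hw' : w ∈ Submodule.span ℂ (Set.range ![v, w]) := Submodule.subset_span ⟨1, rfl⟩
        refine hρ.eq_top (fun g => ?_) hv' hv0
        refine Submodule.span_le (p := (Submodule.span ℂ (Set.range ![v, w])).comap (ρ g)).2 ?_
        rintro _ ⟨a, rfl⟩
        simp only [SetLike.mem_coe, Submodule.mem_comap]
        rcases g with j | j <;> fin_cases a
        · exact hv j ▸ Submodule.smul_mem _ _ hv'
        · exact hrw j ▸ Submodule.smul_mem _ _ hw'
        · exact hsv j ▸ Submodule.smul_mem _ _ hw'
        · exact hsw j ▸ Submodule.smul_mem _ _ hv'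
      let b := Module.Basis.mk hli hspan.ge
      have hb0 : b 0 = v := by simp [b]
      have hb1 : b 1 = w := by simp [b]
      ext (j | j)
      · rw [Representation.character, LinearMap.trace_eq_matrix_trace ℂ b, Matrix.trace_fin_two,
          LinearMap.toMatrix_apply, LinearMap.toMatrix_apply, hb0, hb1, hv, hrw, ← hb0, ← hb1]
        simp [twoDimChar]
      · rw [Representation.character, LinearMap.trace_eq_matrix_trace ℂ b, Matrix.trace_fin_two,
          LinearMap.toMatrix_apply, LinearMap.toMatrix_apply, hb0, hb1, hsv, hsw, ← hb0, ← hb1]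
        simp [twoDimChar]
    · have hi' : ∀ j, -(i * j) = i * j := fun j => by
        rw [← neg_mul, ← not_not.1 hi]
      refine Or.inl (hρ.character_one_eq_one (v := v + w) (fun h => ?_) ?_)
      · have := LinearIndependent.pair_iff.1 hli 1 1 (by simpa using h)
        exact one_ne_zero this.1
      · rintro (j | j)
        · exact ⟨stdAddChar (i * j), by rw [map_add, hv, hrw, hi', smul_add]⟩
        · exact ⟨stdAddChar (i * j), by rw [map_add, hsv, hsw, hi', smul_add, add_comm]⟩
  · rw [LinearIndependent.pair_iff' hv0] at hli
    push Not at hli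
    obtain ⟨a, ha⟩ := hli
    refine Or.inl (hρ.character_one_eq_one hv0 ?_)
    rintro (j | j)
    · exact ⟨_, hv j⟩
    · exact ⟨_, by rw [hsv, ← ha, smul_smul]⟩

/-- The two-dimensional representation of `DihedralGroup n` with character `twoDimChar i`, in
matrix form. -/
noncomputable def twoDimMatrix (i : ZMod n) : DihedralGroup n →* Matrix (Fin 2) (Fin 2) ℂ where
  toFun
    | r j => !![stdAddChar (i * j), 0; 0, stdAddChar (-(i * j))]
    | sr j => !![0, stdAddChar (-(i * j)); stdAddChar (i * j), 0]
  map_one' := by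
    rw [one_def]
    simp [Matrix.one_fin_two]
  map_mul' := by
    rintro (a | a) (b | b) <;>
      simp [← AddChar.map_add_eq_mul] <;> constructor <;> ring_nf

/-- The two-dimensional representation of `DihedralGroup n` with character `twoDimChar i`. -/
noncomputable def twoDimRep (i : ZMod n) : Representation ℂ (DihedralGroup n) (Fin 2 → ℂ) :=
  (Matrix.toLinAlgEquiv' : Matrix (Fin 2) (Fin 2) ℂ ≃ₐ[ℂ] _).toMonoidHom.comp (twoDimMatrix i)

theorem twoDimRep_apply (i : ZMod n) (g : DihedralGroup n) (v : Fin 2 → ℂ) :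
    twoDimRep i g v = (twoDimMatrix i g).mulVec v := rfl

theorem twoDimRep_r (i j : ZMod n) (a b : ℂ) :
    twoDimRep i (r j) ![a, b] = ![stdAddChar (i * j) * a, stdAddChar (-(i * j)) * b] := by
  ext k
  fin_cases k <;> simp [twoDimRep_apply, twoDimMatrix, Matrix.mulVec, dotProduct]

theorem twoDimRep_sr_zero (i : ZMod n) (a b : ℂ) : twoDimRep i (sr 0) ![a, b] = ![b, a] := by
  ext k
  fin_cases k <;> simp [twoDimRep_apply, twoDimMatrix, Matrix.mulVec, dotProduct]

theorem character_twoDimRep (i : ZMod n) : (twoDimRep i).character = twoDimChar i := by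
  ext (j | j)
  all_goals
    refine (Matrix.trace_toLin'_eq (twoDimMatrix i _)).trans ?_
    simp [twoDimMatrix, twoDimChar, Matrix.trace_fin_two]

theorem isIrreducible_twoDimRep {i : ZMod n} (hi : i ∈ nonSelfNeg n) :
    (twoDimRep i).IsIrreducible := by
  refine Representation.isIrreducible_of_forall_eq_top fun W hW u hu hu0 => ?_
  obtain ⟨a, b, rfl⟩ : ∃ a b, u = ![a, b] := ⟨u 0, u 1, by ext k; fin_cases k <;> rfl⟩
  have hne : (stdAddChar i - stdAddChar (-i) : ℂ) ≠ 0 :=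
    sub_ne_zero.2 fun h => hi (injective_stdAddChar h)
  -- Subtracting `stdAddChar (-i)` from the action of `r 1` kills the second coordinate and scales
  -- the first by a nonzero factor.
  have key : ∀ a b : ℂ, ![a, b] ∈ W → a ≠ 0 → ![(1 : ℂ), 0] ∈ W := by
    intro a b hab ha
    have h1 := W.smul_mem ((stdAddChar i - stdAddChar (-i)) * a : ℂ)⁻¹
      (W.sub_mem (hW (r 1) _ hab) (W.smul_mem (stdAddChar (-i) : ℂ) hab))
    rw [twoDimRep_r] at h1
    convert h1 using 1
    ext k
    fin_cases k
    · simp only [mul_one, Fin.zero_eta, Matrix.cons_val_zero, Pi.smul_apply, Pi.sub_apply,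
        smul_eq_mul]
      field_simp
    · simp
  have h0 : ![(1 : ℂ), 0] ∈ W := by
    by_cases ha : a = 0
    · refine key b a (twoDimRep_sr_zero i a b ▸ hW (sr 0) _ hu) fun hb => hu0 ?_
      simp [ha, hb]
    · exact key a b hu ha
  have h1 : ![(0 : ℂ), 1] ∈ W := twoDimRep_sr_zero i 1 0 ▸ hW (sr 0) _ h0
  refine eq_top_iff.2 fun x _ => ?_
  have hx : x = x 0 • ![(1 : ℂ), 0] + x 1 • ![(0 : ℂ), 1] := by
    ext k; fin_cases k <;> simp
  rw [hx]
  exact W.add_mem (W.smul_mem _ h0) (W.smul_mem _ h1)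

theorem finprod_irrChars_one :
    ∏ᶠ χ ∈ irrChars (DihedralGroup n), χ 1 = 2 ^ (twoDimChar '' nonSelfNeg n).ncard := by
  rw [← finprod_mem_eq_pow_ncard ((nonSelfNeg n).toFinite.image twoDimChar) (f := fun χ => χ 1)]
  -- Linear characters contribute a factor 1, so they need not be classified.
  · refine finprod_mem_inter_mulSupport_eq' _ _ _ fun χ hχ => ⟨?_, ?_⟩
    · rintro ⟨d, ρ, hρ, rfl⟩
      obtain h | ⟨i, hi, h⟩ := character_eq_twoDimChar hρ
      · exact absurd h hχ
      · exact ⟨i, hi, h.symm⟩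
    · rintro ⟨i, hi, rfl⟩
      exact ⟨2, twoDimRep i, isIrreducible_twoDimRep hi, (character_twoDimRep i).symm⟩
  · rintro _ ⟨i, -, rfl⟩
    exact twoDimChar_one i

theorem haradaNumber_eq :
    haradaNumber (DihedralGroup n) = (Nat.card (doubles n) : ℂ) ^ (doubles n).index := by
  rw [haradaNumber, finprod_card_conjClasses, finprod_irrChars_one,
    Set.ncard_image_eq_ncard_image_of_iff (g := twoDimChar)
      fun i _ j _ => mk_r_eq_mk_r.trans twoDimChar_eq_iff.symm]
  exact mul_div_cancel_left₀ _ (pow_ne_zero _ two_ne_zero)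

end DihedralGroup

theorem mainTheorem8 (n : ℕ) (hn : 0 < n) :
    (Odd n →
      haradaNumber (DihedralGroup n) = (n : ℂ) ∧
        n = Nat.card (commutator (DihedralGroup n))) ∧
    (Even n →
      haradaNumber (DihedralGroup n) = (n : ℂ) ^ 2 / 4 ∧
        (n : ℂ) ^ 2 / 4 = (Nat.card (commutator (DihedralGroup n)) : ℂ) ^ 2) := by
  have : NeZero n := ⟨hn.ne'⟩
  rw [haradaNumber_eq, card_commutator, ZMod.card_doubles, ZMod.index_doubles]
  constructor
  · intro h
    simp [Nat.coprime_two_right.2 h |>.gcd_eq_one]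
  · intro h
    obtain ⟨m, rfl⟩ := h.two_dvd
    have hm : (m : ℂ) ^ 2 = (2 * m) ^ 2 / 4 := by ring
    simp [hm]
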